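/- For mass functions $p,q$ on $[k]=\{1,\dots,k\}$ let $d_{\mathrm H}(p,q)=\frac1{\sqrt2}\big(\sum_{i=1}^k(\sqrt{p(i)}-\sqrt{q(i)})^2\big)^{1/2}$ be the Hellinger distance. Let $\Phi(d_{\mathrm H},k,\varepsilon,\delta)$ be the sample complexity of learning distributions over $[k]$: the least $n$ for which there is a (possibly randomized) learner that, given $n$ independent samples from an arbitrary unknown probability distribution $p$ on $[k]$, outputs a probability distribution $q$ on $[k]$ such that $d_{\mathrm H}(p,q)\le\varepsilon$ with probability at least $1-\delta$. Then $\Phi(d_{\mathrm H},k,\varepsilon,\delta)=\Theta\big(\frac{k+\log(1/\delta)}{\varepsilon^2}\big)$, and the upper bound is attained by the empirical distribution. Precisely, there are absolute constants $c,C,\varepsilon_0,\delta_0>0$ such that: 1. (Lower bound) for all integers $k\ge2$, all $0<\varepsilon\le\varepsilon_0$ and all $0<\delta\le\delta_0$, $$\Phi(d_{\mathrm H},k,\varepsilon,\delta)\ \ge\ c\,\frac{k+\log(1/\delta)}{\varepsilon^2};$$ 2. (Upper bound) for all integers $k\ge1$, all $\varepsilon>0$ and all $\delta\in(0,1]$,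 $$\Phi(d_{\mathrm H},k,\varepsilon,\delta)\ \le\ C\,\frac{k+\log(1/\delta)}{\varepsilon^2};$$ 3. (Empirical distribution) for all integers $k\ge1$, all $\varepsilon>0$, all $\delta\in(0,1]$, every integer $n\ge C\,\frac{k+\log(1/\delta)}{\varepsilon^2}$ and every probability distribution $p$ on $[k]$, the empirical distribution $\widehat p(i)=\frac1n\#\{j\le n: s_j=i\}$ of $n$ independent samples $s_1,\dots,s_n$ from $p$ satisfies $d_{\mathrm H}(p,\widehat p)\le\varepsilon$ with probability at least $1-\delta$. -/

import Mathlib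

open MeasureTheory ProbabilityTheory

noncomputable section

/-- Probability distributions on a domain of size `k`, given by their mass functions. -/
abbrev FinDistrib (k : ℕ) : Type := stdSimplex ℝ (Fin k)

/-- The Hellinger distance `(1/√2) ‖√p - √q‖₂` of two mass functions. -/
def hellinger {k : ℕ} (p q : Fin k → ℝ) : ℝ :=
  1 / Real.sqrt 2 * Real.sqrt (∑ i, (Real.sqrt (p i) - Real.sqrt (q i)) ^ 2)

/-- The probability measure on the domain with mass function `p`. -/
def FinDistrib.toMeasure {k : ℕ} (p : FinDistrib k) : Measure (Fin k) :=
  ∑ i, ENNReal.ofReal (p.1 i) • Measure.dirac i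

/-- The joint law of `n` independent samples from `p`. -/
def sampleLaw {k : ℕ} (n : ℕ) (p : FinDistrib k) : Measure (Fin n → Fin k) :=
  Measure.pi fun _ => p.toMeasure

/-- `n` samples suffice for learning to accuracy `ε` in the distance `d` with failure probability
`δ`: some learner, deterministic or randomized (a Markov kernel from samples to distributions),
outputs, for every unknown `p`, a distribution `q` with `d p q ≤ ε` with probability at least
`1 - δ`, over the samples and over the internal randomness of the learner. -/
def Learnable (k : ℕ) (d : (Fin k → ℝ) → (Fin k → ℝ) → ℝ) (ε δ : ℝ) (n : ℕ) : Prop :=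
  ∃ κ : Kernel (Fin n → Fin k) (FinDistrib k), IsMarkovKernel κ ∧
    ∀ p : FinDistrib k,
      ENNReal.ofReal (1 - δ) ≤ ((sampleLaw n p).bind κ) {q : FinDistrib k | d p.1 q.1 ≤ ε}

/-- The sample complexity: the least number of samples that suffices (`⊤` if none does). -/
def sampleComplexity (k : ℕ) (d : (Fin k → ℝ) → (Fin k → ℝ) → ℝ) (ε δ : ℝ) : ℕ∞ :=
  ⨅ n ∈ {n : ℕ | Learnable k d ε δ n}, (n : ℕ∞)

/-- The empirical mass function `i ↦ #{j | s j = i} / n` of the samples `s`. -/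
def empirical {k n : ℕ} (s : Fin n → Fin k) : Fin k → ℝ :=
  fun i => (∑ j, if s j = i then (1 : ℝ) else 0) / n

end

/-! **Upper bound.** Let `H` be the Hellinger distance from `p` to the empirical distribution `q` of
the sample `s`. Then `n H² = ∑ j, (1 - √(p (s j) / q (s j)))`. Since
`a * exp (1 - √(a / b)) ≤ √(a * b)`, the exponential moment of `n H²` is at most
`∑ s, ∏ j, √(p (s j) * q (s j))`, which no longer involves an exponential. Group the samples by
their counts and add the letters one at a time:
Chernoff's bound turns the term of each count of the new letter into an increment of the square root
of a binomial tail, so that the sum over the counts telescopes and each letter costs a factor `4`.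
Hence the moment is at most `4 ^ k`, and Markov's inequality concludes.

**Lower bound.** Split the letters into pairs and tilt the uniform distribution inside each pair by
a relative amount `12 ε`, the direction being one bit per pair. Two such distributions differing in
one bit have Bhattacharyya coefficient close to `1`, whereas an `ε`-accurate output determines most
of the bits. Averaging over all bit vectors (Assouad) gives the term `k`; a single pair (Le Cam)
gives the term `log (1 / δ)`. -/

section BinomialTail

open Finset

/-- The mass that the binomial weights `n.choose j * (p ^ j * q ^ (n - j))` give to `j ≥ a`. The
weights are not normalized by `p + q = 1`, since the alphabet is later split letter by letter. -/
noncomputable def binomialTail (p q : ℝ) (n a : ℕ) : ℝ :=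
  ∑ j ∈ Ico a (n + 1), (n.choose j : ℝ) * (p ^ j * q ^ (n - j))

theorem binomialTail_zero (p q : ℝ) (n : ℕ) : binomialTail p q n 0 = (p + q) ^ n := by
  rw [binomialTail, add_pow, ← range_eq_Ico]
  exact sum_congr rfl fun j _ => by ring

theorem binomialTail_add_eq_add_succ (p q : ℝ) (a b : ℕ) :
    binomialTail p q (a + b) a =
      ((a + b).choose a : ℝ) * (p ^ a * q ^ b) + binomialTail p q (a + b) (a + 1) := by
  rw [binomialTail, sum_eq_sum_Ico_succ_bot (by omega), Nat.add_sub_cancel_left, binomialTail]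

variable {p q : ℝ}

theorem binomialTail_nonneg (hp : 0 ≤ p) (hq : 0 ≤ q) (n a : ℕ) : 0 ≤ binomialTail p q n a :=
  sum_nonneg fun _ _ => by positivity

theorem binomialTail_succ_le (hp : 0 ≤ p) (hq : 0 ≤ q) (n a : ℕ) :
    binomialTail p q n (a + 1) ≤ binomialTail p q n a :=
  sum_le_sum_of_subset_of_nonneg (Ico_subset_Ico_left a.le_succ) fun _ _ _ => by positivity

-- Chernoff's bound: tilting `(p, q)` to `(a, b)` multiplies the weight of `j ≥ a` by at least as
-- much as the weight of `a`, and the tilted weights sum to `(a + b) ^ (a + b)`.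
theorem binomialTail_mul_le (hp : 0 ≤ p) (hq : 0 ≤ q) {a b : ℕ} (h : b * p ≤ a * q) :
    binomialTail p q (a + b) a * ((a : ℝ) ^ a * (b : ℝ) ^ b) ≤
      p ^ a * q ^ b * ((a + b : ℕ) : ℝ) ^ (a + b) := by
  have tilt : ∀ j ∈ Ico a (a + b + 1),
      ((a + b).choose j : ℝ) * (p ^ j * q ^ (a + b - j)) * ((a : ℝ) ^ a * (b : ℝ) ^ b) ≤
        p ^ a * q ^ b * (((a + b).choose j : ℝ) * ((a : ℝ) ^ j * (b : ℝ) ^ (a + b - j))) := by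
    intro j hj
    obtain ⟨hja, hjn⟩ := mem_Ico.1 hj
    obtain ⟨d, rfl⟩ := Nat.exists_eq_add_of_le hja
    obtain ⟨e, rfl⟩ : ∃ e, b = d + e := Nat.exists_eq_add_of_le (by omega)
    have hpow : (((d + e : ℕ) : ℝ) * p) ^ d ≤ (a * q) ^ d := by gcongr
    rw [show a + (d + e) - (a + d) = e by omega]
    calc ((a + (d + e)).choose (a + d) : ℝ) * (p ^ (a + d) * q ^ e) *
          ((a : ℝ) ^ a * ((d + e : ℕ) : ℝ) ^ (d + e))
        = ((a + (d + e)).choose (a + d) : ℝ) * (p ^ a * q ^ e * a ^ a * ((d + e : ℕ) : ℝ) ^ e) *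
          (((d + e : ℕ) : ℝ) * p) ^ d := by ring
      _ ≤ ((a + (d + e)).choose (a + d) : ℝ) * (p ^ a * q ^ e * a ^ a * ((d + e : ℕ) : ℝ) ^ e) *
          (a * q) ^ d := by gcongr
      _ = _ := by ring
  calc binomialTail p q (a + b) a * ((a : ℝ) ^ a * (b : ℝ) ^ b)
      ≤ p ^ a * q ^ b * binomialTail a b (a + b) a := by
        rw [binomialTail, binomialTail, sum_mul, mul_sum]
        exact sum_le_sum tilt
    _ ≤ p ^ a * q ^ b * binomialTail a b (a + b) 0 := by
        gcongr
        exact sum_le_sum_of_subset_of_nonneg (Ico_subset_Ico_left a.zero_le)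
          fun _ _ _ => by positivity
    _ = p ^ a * q ^ b * ((a + b : ℕ) : ℝ) ^ (a + b) := by rw [binomialTail_zero, Nat.cast_add]

theorem sq_sqrt_pow {x : ℝ} (hx : 0 ≤ x) (n : ℕ) : (√x ^ n) ^ 2 = x ^ n := by
  rw [pow_right_comm, Real.sq_sqrt hx]

theorem sub_le_two_mul_sqrt_mul_sqrt_sub_sqrt {x y : ℝ} (hy : 0 ≤ y) (hxy : y ≤ x) :
    x - y ≤ 2 * √x * (√x - √y) := by
  nlinarith [Real.sqrt_le_sqrt hxy, Real.sq_sqrt hy, Real.sq_sqrt (hy.trans hxy),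
    sq_nonneg (√x - √y)]

theorem sqrt_binomialTail_mul_le (hp : 0 ≤ p) (hq : 0 ≤ q) {a b : ℕ} (h : b * p ≤ a * q) :
    √(binomialTail p q (a + b) a) * (√(p * a) ^ a * √(q * b) ^ b) ≤
      p ^ a * q ^ b * √((a + b : ℕ) : ℝ) ^ (a + b) := by
  have hpq : 0 ≤ p ^ a * q ^ b := by positivity
  refine le_of_sq_le_sq ?_ (by positivity)
  rw [mul_pow, mul_pow, mul_pow, Real.sq_sqrt (binomialTail_nonneg hp hq _ _),
    sq_sqrt_pow (by positivity), sq_sqrt_pow (by positivity), sq_sqrt_pow (by positivity)]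
  calc _ = p ^ a * q ^ b *
        (binomialTail p q (a + b) a * ((a : ℝ) ^ a * (b : ℝ) ^ b)) := by ring
    _ ≤ p ^ a * q ^ b * (p ^ a * q ^ b * ((a + b : ℕ) : ℝ) ^ (a + b)) :=
        mul_le_mul_of_nonneg_left (binomialTail_mul_le hp hq h) hpq
    _ = _ := by ring

-- The left side is at most a multiple of `(T a - T (a + 1)) / √(T a)`, with `T` the tail.
theorem choose_mul_sqrt_pow_mul_sqrt_pow_le (hp : 0 ≤ p) (hq : 0 ≤ q) {a b : ℕ}
    (h : b * p ≤ a * q) :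
    ((a + b).choose a : ℝ) * (√(p * a) ^ a * √(q * b) ^ b) ≤
      2 * √((a + b : ℕ) : ℝ) ^ (a + b) *
        (√(binomialTail p q (a + b) a) - √(binomialTail p q (a + b) (a + 1))) := by
  set c : ℝ := ((a + b).choose a : ℝ)
  set w := √(p * a) ^ a * √(q * b) ^ b
  set r := √((a + b : ℕ) : ℝ) ^ (a + b)
  have hT'0 := binomialTail_nonneg hp hq (a + b) (a + 1)
  have hT'T := binomialTail_succ_le hp hq (a + b) a
  have hsub : c * (p ^ a * q ^ b) = binomialTail p q (a + b) a - binomialTail p q (a + b) (a + 1) :=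
    eq_sub_of_add_eq (binomialTail_add_eq_add_succ p q a b).symm
  have hchernoff := sqrt_binomialTail_mul_le hp hq h
  set T := binomialTail p q (a + b) a
  set T' := binomialTail p q (a + b) (a + 1)
  rcases (hT'0.trans hT'T).eq_or_lt with hTz | hTpos
  · have hc : c ≠ 0 := Nat.cast_ne_zero.2 (Nat.choose_pos (Nat.le_add_right a b)).ne'
    have hT'z : T' = 0 := le_antisymm (hT'T.trans_eq hTz.symm) hT'0
    have hm : p ^ a * q ^ b = 0 := by simpa [← hTz, hT'z, hc] using hsub
    have hw : w ^ 2 = p ^ a * q ^ b * ((a : ℝ) ^ a * (b : ℝ) ^ b) := by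
      rw [mul_pow, sq_sqrt_pow (by positivity), sq_sqrt_pow (by positivity)]
      ring
    have hwz : w = 0 := by simpa [hm] using hw
    simp [← hTz, hT'z, hwz]
  · refine le_of_mul_le_mul_left ?_ (Real.sqrt_pos.2 hTpos)
    calc √T * (c * w) = c * (√T * w) := by ring
      _ ≤ c * (p ^ a * q ^ b * r) := by gcongr
      _ = r * (T - T') := by rw [← hsub]; ring
      _ ≤ r * (2 * √T * (√T - √T')) := by
        gcongr
        exact sub_le_two_mul_sqrt_mul_sqrt_sub_sqrt hT'0 hT'T
      _ = _ := by ring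

theorem sum_antidiagonal_filter_choose_mul_sqrt_pow_le (hp : 0 ≤ p) (hq : 0 ≤ q) (n : ℕ) :
    ∑ x ∈ antidiagonal n with x.2 * p ≤ x.1 * q,
      (n.choose x.1 : ℝ) * (√(p * x.1) ^ x.1 * √(q * x.2) ^ x.2) ≤
        2 * √(n * (p + q)) ^ n := by
  set T := binomialTail p q n
  have hdiff : ∀ a, 0 ≤ √(T a) - √(T (a + 1)) := fun a =>
    sub_nonneg.2 (Real.sqrt_le_sqrt (binomialTail_succ_le hp hq n a))
  calc _ ≤ ∑ x ∈ antidiagonal n with x.2 * p ≤ x.1 * q,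
          2 * √(n : ℝ) ^ n * (√(T x.1) - √(T (x.1 + 1))) := by
        refine sum_le_sum fun x hx => ?_
        obtain ⟨hxn, hx⟩ := mem_filter.1 hx
        have := choose_mul_sqrt_pow_mul_sqrt_pow_le hp hq hx
        rwa [mem_antidiagonal.1 hxn] at this
    _ ≤ ∑ x ∈ antidiagonal n, 2 * √(n : ℝ) ^ n * (√(T x.1) - √(T (x.1 + 1))) :=
        sum_le_sum_of_subset_of_nonneg (filter_subset _ _) fun x _ _ =>
          mul_nonneg (by positivity) (hdiff x.1)
    _ = 2 * √(n : ℝ) ^ n * (√(T 0) - √(T (n + 1))) := by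
        rw [← mul_sum, Nat.sum_antidiagonal_eq_sum_range_succ
          (fun a _ => √(T a) - √(T (a + 1))), sum_range_sub']
    _ ≤ 2 * √(n : ℝ) ^ n * √(T 0) := by
        gcongr
        exact sub_le_self _ (Real.sqrt_nonneg _)
    _ = 2 * √(n * (p + q)) ^ n := by
        have hpq := add_nonneg hp hq
        have hsqrt : √(T 0) = √(p + q) ^ n := by
          rw [show T 0 = (p + q) ^ n from binomialTail_zero p q n, ← sq_sqrt_pow hpq,
            Real.sqrt_sq (by positivity)]
        rw [hsqrt, Real.sqrt_mul n.cast_nonneg, mul_pow, mul_assoc]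

theorem sum_antidiagonal_choose_mul_sqrt_pow_le (hp : 0 ≤ p) (hq : 0 ≤ q) (n : ℕ) :
    ∑ x ∈ antidiagonal n, (n.choose x.1 : ℝ) * (√(p * x.1) ^ x.1 * √(q * x.2) ^ x.2) ≤
      4 * √(n * (p + q)) ^ n := by
  have hleft : ∑ x ∈ antidiagonal n with ¬ (x.2 * p ≤ x.1 * q),
      (n.choose x.1 : ℝ) * (√(p * x.1) ^ x.1 * √(q * x.2) ^ x.2) ≤ 2 * √(n * (p + q)) ^ n := by
    refine le_trans ?_
      ((sum_antidiagonal_filter_choose_mul_sqrt_pow_le hq hp n).trans_eq (by rw [add_comm q p]))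
    rw [sum_filter, sum_filter, ← Nat.sum_antidiagonal_swap]
    refine sum_le_sum fun x hx => ?_
    simp only [Prod.fst_swap, Prod.snd_swap,
      Nat.choose_symm_of_eq_add (mem_antidiagonal.1 hx).symm, mul_comm (√(p * x.2) ^ x.2)]
    split_ifs with hlt hle hle
    · positivity
    · exact le_rfl
    · exact le_rfl
    · exact absurd (not_le.1 hlt).le hle
  rw [← sum_filter_add_sum_filter_not _ (fun x : ℕ × ℕ => x.2 * p ≤ x.1 * q)]
  linarith [sum_antidiagonal_filter_choose_mul_sqrt_pow_le hp hq n]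

end BinomialTail

section Multinomial

open Finset

variable {α : Type*} [DecidableEq α]

theorem sum_piAntidiag_insert_multinomial_mul_prod {R : Type*} [CommSemiring R]
    (w : α → ℕ → R) {i : α} {S : Finset α} (hi : i ∉ S) (n : ℕ) :
    ∑ N ∈ piAntidiag (insert i S) n,
        (Nat.multinomial (insert i S) N : R) * ∏ j ∈ insert i S, w j (N j) =
      ∑ x ∈ antidiagonal n, (n.choose x.1 : R) * w i x.1 *
        ∑ N ∈ piAntidiag S x.2, (Nat.multinomial S N : R) * ∏ j ∈ S, w j (N j) := by
  simp only [← cons_eq_insert i S hi, piAntidiag_cons hi, sum_disjiUnion, sum_map, mul_sum]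
  refine sum_congr rfl fun x hx => sum_congr rfl fun N hN => ?_
  obtain ⟨hNsum, hNsupp⟩ := mem_piAntidiag.1 hN
  set N' := addRightEmbedding (fun j => if j = i then x.1 else 0) N
  have hN'S : ∀ j ∈ S, N' j = N j := fun j hj => by
    simp [N', show j ≠ i by rintro rfl; exact hi hj]
  have hN'i : N' i = x.1 := by
    simpa [N'] using not_imp_comm.1 (hNsupp i) hi
  have hsum : N' i + ∑ j ∈ S, N' j = n := by
    rw [hN'i, sum_congr rfl hN'S, hNsum, mem_antidiagonal.1 hx]
  rw [Nat.multinomial_cons, prod_cons, hsum, hN'i, Nat.multinomial_congr hN'S,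
    prod_congr rfl fun j hj => by rw [hN'S j hj]]
  push_cast
  ring

theorem sum_piAntidiag_multinomial_mul_prod_sqrt_pow_le {p : α → ℝ} (hp : ∀ i, 0 ≤ p i)
    (S : Finset α) (n : ℕ) :
    ∑ N ∈ piAntidiag S n, (Nat.multinomial S N : ℝ) * ∏ i ∈ S, √(p i * N i) ^ N i ≤
      4 ^ #S * √(n * ∑ i ∈ S, p i) ^ n := by
  induction S using Finset.induction_on generalizing n with
  | empty => rcases n with _ | n <;> simp
  | insert i S hi ih =>
    rw [sum_piAntidiag_insert_multinomial_mul_prod (fun i N => √(p i * N) ^ N) hi,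
      card_insert_of_notMem hi, sum_insert hi]
    set P := ∑ i ∈ S, p i
    have hP : 0 ≤ P := sum_nonneg fun i _ => hp i
    calc _ ≤ ∑ x ∈ antidiagonal n, (n.choose x.1 : ℝ) * √(p i * x.1) ^ x.1 *
            (4 ^ #S * √(x.2 * P) ^ x.2) := by
          gcongr with x
          exact ih x.2
      _ = 4 ^ #S * ∑ x ∈ antidiagonal n,
            (n.choose x.1 : ℝ) * (√(p i * x.1) ^ x.1 * √(P * x.2) ^ x.2) := by
          rw [mul_sum]
          exact sum_congr rfl fun x _ => by rw [mul_comm P]; ring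
      _ ≤ 4 ^ #S * (4 * √(n * (p i + P)) ^ n) := by
          gcongr
          exact sum_antidiagonal_choose_mul_sqrt_pow_le (hp i) hP n
      _ = _ := by ring

end Multinomial

section SampleCount

open Finset

variable {α : Type*} [DecidableEq α] {n : ℕ}

/-- The number of occurrences of the letter `i` in the sample `s`. -/
def sampleCount (s : Fin n → α) (i : α) : ℕ := #{j | s j = i}

variable [Fintype α]

@[to_additive]
theorem prod_comp_eq_prod_pow_sampleCount {M : Type*} [CommMonoid M] (s : Fin n → α) (f : α → M) :
    ∏ j, f (s j) = ∏ i, f i ^ sampleCount s i := by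
  simp only [← prod_fiberwise' univ s f, sampleCount, prod_const]

theorem sum_sampleCount (s : Fin n → α) : ∑ i, sampleCount s i = n := by
  simpa [sampleCount] using
    (card_eq_sum_card_fiberwise (f := s) (s := univ) (t := univ) (by simp)).symm

-- The number of samples with given counts is read off by expanding `(∑ i, X i) ^ n` in two ways.
theorem sum_comp_sampleCount {M : Type*} [AddCommMonoid M] (F : (α → ℕ) → M) (n : ℕ) :
    ∑ s : Fin n → α, F (sampleCount s) =
      ∑ N ∈ piAntidiag univ n, Nat.multinomial univ N • F N := by
  let L : MvPolynomial α ℕ →ₗ[ℕ] M :=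
    (MvPolynomial.basisMonomials α ℕ).constr ℕ fun d => F d
  have hL (N : α → ℕ) : L (∏ i, MvPolynomial.X i ^ N i) = F N := by
    have hmonomial : ∏ i, (MvPolynomial.X i : MvPolynomial α ℕ) ^ N i =
        MvPolynomial.basisMonomials α ℕ (Finsupp.equivFunOnFinite.symm N) := by
      simp [MvPolynomial.monomial_eq, Finsupp.prod_fintype]
    rw [hmonomial, Module.Basis.constr_basis, Finsupp.coe_equivFunOnFinite_symm]
  calc ∑ s : Fin n → α, F (sampleCount s)
      = L ((∑ i, MvPolynomial.X i) ^ n) := by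
        simp only [Fintype.sum_pow, map_sum, prod_comp_eq_prod_pow_sampleCount, hL]
    _ = _ := by
        simp only [sum_pow_eq_sum_piAntidiag, map_sum, ← nsmul_eq_mul, map_nsmul, hL]

theorem sum_prod_sqrt_pow_sampleCount_le {p : α → ℝ} (hp : ∀ i, 0 ≤ p i) (n : ℕ) :
    ∑ s : Fin n → α, ∏ i, √(p i * sampleCount s i) ^ sampleCount s i ≤
      4 ^ Fintype.card α * √(n * ∑ i, p i) ^ n := by
  rw [sum_comp_sampleCount fun N => ∏ i, √(p i * N i) ^ N i]
  simp only [nsmul_eq_mul]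
  exact sum_piAntidiag_multinomial_mul_prod_sqrt_pow_le hp univ n

end SampleCount

section Hellinger

/-- The Bhattacharyya coefficient `∑ i, √(p i q i)` of two mass functions: the affinity that is
multiplicative under products and equals `1 - H²` for the Hellinger distance `H`. -/
noncomputable def bhattacharyya {α : Type*} [Fintype α] (p q : α → ℝ) : ℝ :=
  ∑ i, √(p i) * √(q i)

variable {k : ℕ}

theorem hellinger_nonneg (p q : Fin k → ℝ) : 0 ≤ hellinger p q := by
  rw [hellinger]
  positivity

theorem hellinger_sq (p q : Fin k → ℝ) :
    hellinger p q ^ 2 = (∑ i, (√(p i) - √(q i)) ^ 2) / 2 := by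
  rw [hellinger, mul_pow, div_pow, Real.sq_sqrt (by positivity),
    Real.sq_sqrt (Finset.sum_nonneg fun i _ => sq_nonneg _)]
  ring

theorem hellinger_sq_eq_one_sub_bhattacharyya {p q : Fin k → ℝ} (hp : p ∈ stdSimplex ℝ (Fin k))
    (hq : q ∈ stdSimplex ℝ (Fin k)) : hellinger p q ^ 2 = 1 - bhattacharyya p q := by
  have expand (i) : (√(p i) - √(q i)) ^ 2 = p i + q i - 2 * (√(p i) * √(q i)) := by
    rw [sub_sq, Real.sq_sqrt (hp.1 i), Real.sq_sqrt (hq.1 i)]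
    ring
  simp only [hellinger_sq, expand, Finset.sum_sub_distrib, Finset.sum_add_distrib, hp.2, hq.2,
    ← Finset.mul_sum, bhattacharyya]
  ring

theorem hellinger_le_one (p q : FinDistrib k) : hellinger p.1 q.1 ≤ 1 := by
  have hsq := hellinger_sq_eq_one_sub_bhattacharyya p.2 q.2
  have hbc : 0 ≤ bhattacharyya p.1 q.1 := Finset.sum_nonneg fun i _ => by positivity
  exact (sq_le_one_iff₀ (hellinger_nonneg _ _)).1 (by linarith)

theorem FinDistrib.measurable_apply (i : Fin k) : Measurable fun q : FinDistrib k => q.1 i :=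
  (measurable_pi_apply i).comp measurable_subtype_coe

theorem measurable_hellinger (p : Fin k → ℝ) :
    Measurable fun q : FinDistrib k => hellinger p q.1 := by
  unfold hellinger
  exact (Finset.measurable_fun_sum _ fun i _ =>
    (measurable_const.sub (FinDistrib.measurable_apply i).sqrt).pow_const 2).sqrt.const_mul _

end Hellinger

section Empirical

variable {k n : ℕ}

theorem empirical_eq (s : Fin n → Fin k) (i : Fin k) : empirical s i = sampleCount s i / n := by
  simp [empirical, sampleCount, Finset.sum_boole]

theorem empirical_mem_stdSimplex (hn : n ≠ 0) (s : Fin n → Fin k) :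
    empirical s ∈ stdSimplex ℝ (Fin k) := by
  refine ⟨fun i => ?_, ?_⟩
  · rw [empirical_eq]
    positivity
  · simp only [empirical_eq]
    rw [← Finset.sum_div, ← Nat.cast_sum, sum_sampleCount, div_self (by exact_mod_cast hn)]

theorem sum_comp_eq_mul_sum_empirical (s : Fin n → Fin k) (f : Fin k → ℝ) :
    ∑ j, f (s j) = n * ∑ i, empirical s i * f i := by
  rcases eq_or_ne n 0 with rfl | hn
  · simp
  rw [sum_comp_eq_sum_nsmul_sampleCount, Finset.mul_sum]
  refine Finset.sum_congr rfl fun i _ => ?_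
  rw [empirical_eq, nsmul_eq_mul]
  field_simp

theorem empirical_apply_pos (s : Fin n → Fin k) (j : Fin n) : 0 < empirical s (s j) := by
  have hn : 0 < n := j.pos
  have hcount : 0 < sampleCount s (s j) := Finset.card_pos.2 ⟨j, by simp⟩
  rw [empirical_eq]
  positivity

theorem mul_hellinger_empirical_sq (p : FinDistrib k) (s : Fin n → Fin k) :
    n * hellinger p.1 (empirical s) ^ 2 = ∑ j, (1 - √(p.1 (s j) / empirical s (s j))) := by
  rcases eq_or_ne n 0 with rfl | hn
  · simp
  have hemp := empirical_mem_stdSimplex hn s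
  rw [hellinger_sq_eq_one_sub_bhattacharyya p.2 hemp, Finset.sum_sub_distrib,
    sum_comp_eq_mul_sum_empirical s fun i => √(p.1 i / empirical s i), mul_sub, bhattacharyya]
  congr 2
  · simp
  · refine Finset.sum_congr rfl fun i _ => ?_
    rw [Real.sqrt_div (p.2.1 i), mul_div_left_comm, Real.div_sqrt]

theorem mul_exp_one_sub_sqrt_div_le {a b : ℝ} (ha : 0 ≤ a) (hb : 0 < b) :
    a * Real.exp (1 - √(a / b)) ≤ √(a * b) := by
  have hx : √(a / b) * Real.exp (1 - √(a / b)) ≤ 1 := by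
    rw [← neg_sub, Real.exp_neg, ← div_eq_mul_inv, div_le_one (Real.exp_pos _)]
    linarith [Real.add_one_le_exp (√(a / b) - 1)]
  have hfactor : a = √(a * b) * √(a / b) := by
    rw [← Real.sqrt_mul (by positivity), show a * b * (a / b) = a ^ 2 by field_simp,
      Real.sqrt_sq ha]
  calc a * Real.exp (1 - √(a / b))
      = √(a * b) * (√(a / b) * Real.exp (1 - √(a / b))) := by
        rw [← mul_assoc, ← hfactor]
    _ ≤ √(a * b) := mul_le_of_le_one_right (Real.sqrt_nonneg _) hx

theorem prod_mul_exp_hellinger_empirical_sq_le (p : FinDistrib k) (s : Fin n → Fin k) :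
    (∏ j, p.1 (s j)) * Real.exp (n * hellinger p.1 (empirical s) ^ 2) ≤
      ∏ j, √(p.1 (s j) * empirical s (s j)) := by
  rw [mul_hellinger_empirical_sq, Real.exp_sum, ← Finset.prod_mul_distrib]
  exact Finset.prod_le_prod (fun j _ => mul_nonneg (p.2.1 _) (Real.exp_nonneg _)) fun j _ =>
    mul_exp_one_sub_sqrt_div_le (p.2.1 _) (empirical_apply_pos s j)

theorem sum_prod_sqrt_mul_empirical_le (p : FinDistrib k) (n : ℕ) :
    ∑ s : Fin n → Fin k, ∏ j, √(p.1 (s j) * empirical s (s j)) ≤ 4 ^ k := by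
  have hdiv (s : Fin n → Fin k) : ∏ j, √(p.1 (s j) * empirical s (s j)) =
      (∏ i, √(p.1 i * sampleCount s i) ^ sampleCount s i) / √n ^ n := by
    simp only [empirical_eq, ← mul_div_assoc, Real.sqrt_div' _ n.cast_nonneg,
      Finset.prod_div_distrib, Finset.prod_const, Finset.card_fin]
    rw [prod_comp_eq_prod_pow_sampleCount s fun i => √(p.1 i * sampleCount s i)]
  have hmoment := sum_prod_sqrt_pow_sampleCount_le p.2.1 n
  rw [p.2.2, mul_one, Fintype.card_fin] at hmoment
  simp only [hdiv, ← Finset.sum_div]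
  exact div_le_of_le_mul₀ (by positivity) (by positivity) hmoment

end Empirical

section SampleLaw

variable {k n : ℕ}

instance (p : FinDistrib k) : IsProbabilityMeasure p.toMeasure where
  measure_univ := by
    simp only [FinDistrib.toMeasure, Measure.coe_finsetSum, Finset.sum_apply, Measure.smul_apply,
      measure_univ, smul_eq_mul, mul_one]
    rw [← ENNReal.ofReal_sum_of_nonneg fun i _ => p.2.1 i, p.2.2, ENNReal.ofReal_one]

instance (p : FinDistrib k) : IsProbabilityMeasure (sampleLaw n p) := by
  unfold sampleLaw
  infer_instance

theorem FinDistrib.toMeasure_singleton (p : FinDistrib k) (i : Fin k) :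
    p.toMeasure {i} = ENNReal.ofReal (p.1 i) := by
  simp [FinDistrib.toMeasure, Set.indicator_apply]

theorem sampleLaw_real_singleton (p : FinDistrib k) (s : Fin n → Fin k) :
    (sampleLaw n p).real {s} = ∏ j, p.1 (s j) := by
  simp [Measure.real, sampleLaw, Measure.pi_singleton, FinDistrib.toMeasure_singleton,
    ENNReal.toReal_prod, ENNReal.toReal_ofReal (p.2.1 _)]

theorem integral_sampleLaw (p : FinDistrib k) (f : (Fin n → Fin k) → ℝ) :
    ∫ s, f s ∂sampleLaw n p = ∑ s, (∏ j, p.1 (s j)) * f s := by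
  simp only [integral_fintype (.of_finite), sampleLaw_real_singleton, smul_eq_mul]

theorem mgf_hellinger_empirical_sq_le (n : ℕ) (p : FinDistrib k) :
    mgf (fun s => hellinger p.1 (empirical s) ^ 2) (sampleLaw n p) n ≤ 4 ^ k := by
  rw [mgf, integral_sampleLaw]
  exact (Finset.sum_le_sum fun s _ => prod_mul_exp_hellinger_empirical_sq_le p s).trans
    (sum_prod_sqrt_mul_empirical_le p n)

theorem sampleLaw_real_lt_hellinger_empirical_le (n : ℕ) (p : FinDistrib k) {ε : ℝ} (hε : 0 ≤ ε) :
    (sampleLaw n p).real {s | ε < hellinger p.1 (empirical s)} ≤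
      Real.exp (-n * ε ^ 2) * 4 ^ k := by
  calc (sampleLaw n p).real {s | ε < hellinger p.1 (empirical s)}
      ≤ (sampleLaw n p).real {s | ε ^ 2 ≤ hellinger p.1 (empirical s) ^ 2} :=
        measureReal_mono fun s hs => Set.mem_ofPred.2 (pow_le_pow_left₀ hε (le_of_lt hs) 2)
    _ ≤ Real.exp (-n * ε ^ 2) *
          mgf (fun s => hellinger p.1 (empirical s) ^ 2) (sampleLaw n p) n :=
        measure_ge_le_exp_mul_mgf _ n.cast_nonneg .of_finite
    _ ≤ _ := by
        gcongr
        exact mgf_hellinger_empirical_sq_le n p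

theorem four_le_exp_two : 4 ≤ Real.exp 2 := by
  rw [show (2 : ℝ) = 1 + 1 by norm_num, Real.exp_add]
  nlinarith [Real.add_one_le_exp (1 : ℝ)]

theorem ofReal_one_sub_le_sampleLaw_hellinger_empirical_le {ε δ : ℝ} (hε : 0 ≤ ε) (hδ : 0 < δ)
    (hn : 2 * k + Real.log (1 / δ) ≤ n * ε ^ 2) (p : FinDistrib k) :
    ENNReal.ofReal (1 - δ) ≤ sampleLaw n p {s | hellinger p.1 (empirical s) ≤ ε} := by
  have hfail : (sampleLaw n p).real {s | ε < hellinger p.1 (empirical s)} ≤ δ :=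
    calc _ ≤ Real.exp (-n * ε ^ 2) * 4 ^ k := sampleLaw_real_lt_hellinger_empirical_le n p hε
      _ ≤ Real.exp (-(2 * k + Real.log (1 / δ))) * Real.exp 2 ^ k := by
        gcongr
        · linarith
        · exact four_le_exp_two
      _ = δ := by
        rw [← Real.exp_nat_mul, ← Real.exp_add, one_div, Real.log_inv]
        convert Real.exp_log hδ using 2
        ring
  rw [ENNReal.ofReal_le_iff_le_toReal (measure_ne_top _ _)]
  have hcompl := probReal_compl_eq_one_sub (μ := sampleLaw n p)
    {s | hellinger p.1 (empirical s) ≤ ε}.toFinite.measurableSet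
  simp only [Set.compl_ofPred, not_le] at hcompl
  change 1 - δ ≤ (sampleLaw n p).real _
  linarith

end SampleLaw

section TwoPoint

variable {α : Type*} [Fintype α] {p q φ : α → ℝ}

theorem sum_sqrt_mul_sqrt_mul_le (hp : ∀ s, 0 ≤ p s) (hq : q ∈ stdSimplex ℝ α)
    (hφ : ∀ s, φ s ∈ Set.Icc 0 1) : ∑ s, √(p s) * √(q s) * φ s ≤ √(∑ s, p s * φ s) := by
  have hmass : √(∑ s, q s * φ s) ≤ 1 := Real.sqrt_le_one.2 <| hq.2 ▸
    Finset.sum_le_sum fun s _ => mul_le_of_le_one_right (hq.1 s) (hφ s).2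
  calc ∑ s, √(p s) * √(q s) * φ s
      = ∑ s, √(p s * φ s) * √(q s * φ s) := by
        refine Finset.sum_congr rfl fun s _ => ?_
        rw [Real.sqrt_mul (hp s), Real.sqrt_mul (hq.1 s), mul_mul_mul_comm,
          Real.mul_self_sqrt (hφ s).1]
    _ ≤ √(∑ s, p s * φ s) * √(∑ s, q s * φ s) :=
        Real.sum_sqrt_mul_sqrt_le _ (fun s => mul_nonneg (hp s) (hφ s).1)
          fun s => mul_nonneg (hq.1 s) (hφ s).1
    _ ≤ √(∑ s, p s * φ s) := mul_le_of_le_one_right (Real.sqrt_nonneg _) hmass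

theorem bhattacharyya_le_sqrt_add_sqrt (hp : p ∈ stdSimplex ℝ α) (hq : q ∈ stdSimplex ℝ α)
    (hφ : ∀ s, φ s ∈ Set.Icc 0 1) :
    bhattacharyya p q ≤ √(∑ s, p s * φ s) + √(∑ s, q s * (1 - φ s)) := by
  refine le_of_eq_of_le ?_ (add_le_add (sum_sqrt_mul_sqrt_mul_le hp.1 hq hφ)
    (sum_sqrt_mul_sqrt_mul_le (φ := fun s => 1 - φ s) hq.1 hp fun s =>
      ⟨sub_nonneg.2 (hφ s).2, sub_le_self _ (hφ s).1⟩))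
  rw [bhattacharyya, ← Finset.sum_add_distrib]
  exact Finset.sum_congr rfl fun s _ => by ring

theorem prod_mem_stdSimplex (hp : p ∈ stdSimplex ℝ α) (n : ℕ) :
    (fun s : Fin n → α => ∏ j, p (s j)) ∈ stdSimplex ℝ (Fin n → α) :=
  ⟨fun _ => Finset.prod_nonneg fun _ _ => hp.1 _, by rw [← Fintype.sum_pow, hp.2, one_pow]⟩

theorem bhattacharyya_prod (hp : ∀ i, 0 ≤ p i) (hq : ∀ i, 0 ≤ q i) (n : ℕ) :
    bhattacharyya (fun s : Fin n → α => ∏ j, p (s j)) (fun s => ∏ j, q (s j)) =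
      bhattacharyya p q ^ n := by
  simp only [bhattacharyya, Fintype.sum_pow, Finset.prod_mul_distrib,
    Real.sqrt_prod _ fun _ _ => hp _, Real.sqrt_prod _ fun _ _ => hq _]

variable {k n : ℕ} {β : Type*} [MeasurableSpace β] (κ : Kernel (Fin n → Fin k) β)

theorem bind_sampleLaw_real_apply [IsFiniteKernel κ] (p : FinDistrib k) {B : Set β}
    (hB : MeasurableSet B) :
    ((sampleLaw n p).bind κ).real B = ∑ s, (∏ j, p.1 (s j)) * (κ s).real B := by
  rw [Measure.real, Measure.bind_apply hB κ.measurable.aemeasurable, lintegral_fintype,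
    ENNReal.toReal_sum fun s _ => ENNReal.mul_ne_top (measure_ne_top _ _) (measure_ne_top _ _)]
  refine Finset.sum_congr rfl fun s _ => ?_
  rw [ENNReal.toReal_mul, ← sampleLaw_real_singleton, mul_comm]
  rfl

theorem bhattacharyya_pow_le_sqrt_bind_add_sqrt_bind_compl [IsMarkovKernel κ] (p q : FinDistrib k)
    {B : Set β} (hB : MeasurableSet B) :
    bhattacharyya p.1 q.1 ^ n ≤
      √(((sampleLaw n p).bind κ).real B) + √(((sampleLaw n q).bind κ).real Bᶜ) := by
  rw [← bhattacharyya_prod p.2.1 q.2.1, bind_sampleLaw_real_apply κ p hB,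
    bind_sampleLaw_real_apply κ q hB.compl]
  simp only [probReal_compl_eq_one_sub hB]
  exact bhattacharyya_le_sqrt_add_sqrt (prod_mem_stdSimplex p.2 n) (prod_mem_stdSimplex q.2 n)
    fun s => ⟨measureReal_nonneg, measureReal_le_one⟩

end TwoPoint

section PairedPerturbation

variable {ι : Type*}

/-- The bit vector `v` with the bit at `a` negated. -/
def flipBit [DecidableEq ι] (a : ι) (v : ι → Bool) : ι → Bool := Function.update v a (!v a)

theorem flipBit_involutive [DecidableEq ι] (a : ι) : Function.Involutive (flipBit a) := by
  intro v
  simp [flipBit]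

/-- The bit vector read off a mass function by comparing the two letters of each pair. -/
noncomputable def decodedBits {α : Type*} (e : ι × Bool → α) (q : α → ℝ) (a : ι) : Bool :=
  decide (q (e (a, false)) < q (e (a, true)))

theorem apply_le_of_decodedBits_ne {α : Type*} {e : ι × Bool → α} {q : α → ℝ} {v : ι → Bool}
    {a : ι} (h : decodedBits e q a ≠ v a) : q (e (a, v a)) ≤ q (e (a, !v a)) := by
  cases hv : v a <;> simp_all [decodedBits, le_of_lt]

variable [Fintype ι]

/-- The uniform mass function on pairs of letters indexed by `ι`, tilted by the relative amount `g`
inside each pair towards the letter selected by the bit vector `v`. -/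
noncomputable def pairMass (g : ℝ) (v : ι → Bool) (x : ι × Bool) : ℝ :=
  (if x.2 = v x.1 then 1 + g else 1 - g) / (2 * Fintype.card ι)

theorem pairMass_nonneg (g : unitInterval) (v : ι → Bool) (x : ι × Bool) :
    0 ≤ pairMass (g : ℝ) v x := by
  obtain ⟨hg0, hg1⟩ := g.2
  unfold pairMass
  split_ifs
  · positivity
  · exact div_nonneg (sub_nonneg.2 hg1) (by positivity)

variable [Nonempty ι]

theorem sum_bool_pairMass (g : ℝ) (v : ι → Bool) (a : ι) :
    ∑ b, pairMass g v (a, b) = 1 / Fintype.card ι := by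
  cases h : v a <;> simp [pairMass, h] <;> field_simp <;> ring

theorem sum_pairMass (g : ℝ) (v : ι → Bool) : ∑ x, pairMass g v x = 1 := by
  simp only [Fintype.sum_prod_type, sum_bool_pairMass]
  simp

theorem bhattacharyya_pairMass_flipBit_ge [DecidableEq ι] (g : unitInterval) (v : ι → Bool)
    (a : ι) :
    1 - (g : ℝ) ^ 2 / Fintype.card ι ≤ bhattacharyya (pairMass g v) (pairMass g (flipBit a v)) := by
  obtain ⟨hg0, hg1⟩ := g.2
  have hflipped (b) : √(pairMass g v (a, b)) * √(pairMass g (flipBit a v) (a, b)) =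
      √(1 - (g : ℝ) ^ 2) / (2 * Fintype.card ι) := by
    rw [← Real.sqrt_mul (pairMass_nonneg g v _),
      show pairMass g v (a, b) * pairMass g (flipBit a v) (a, b) =
          (1 - (g : ℝ) ^ 2) / (2 * Fintype.card ι) ^ 2 by
        cases b <;> cases h : v a <;> simp [pairMass, flipBit, h] <;> field_simp <;> ring,
      Real.sqrt_div' _ (by positivity), Real.sqrt_sq (by positivity)]
  have hfixed (i) (hi : i ≠ a) (b) :
      √(pairMass g v (i, b)) * √(pairMass g (flipBit a v) (i, b)) = pairMass g v (i, b) := by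
    rw [show pairMass (g : ℝ) (flipBit a v) (i, b) = pairMass g v (i, b) by
      simp [pairMass, flipBit, hi], Real.mul_self_sqrt (pairMass_nonneg g v _)]
  have hpair (i) : 1 / (Fintype.card ι : ℝ) - (if i = a then (g : ℝ) ^ 2 / Fintype.card ι else 0) ≤
      ∑ b, √(pairMass g v (i, b)) * √(pairMass g (flipBit a v) (i, b)) := by
    split_ifs with hi
    · subst hi
      have hsqrt : 1 - (g : ℝ) ^ 2 ≤ √(1 - (g : ℝ) ^ 2) :=
        Real.le_sqrt_of_sq_le (by nlinarith [sq_nonneg (g : ℝ), pow_le_one₀ hg0 hg1 (n := 2)])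
      calc _ = (1 - (g : ℝ) ^ 2) / Fintype.card ι := by ring
        _ ≤ √(1 - (g : ℝ) ^ 2) / Fintype.card ι := by gcongr
        _ = _ := by simp only [hflipped, Fintype.sum_bool]; ring
    · simp only [hfixed i hi, sum_bool_pairMass, sub_zero, le_refl]
  calc 1 - (g : ℝ) ^ 2 / Fintype.card ι
      = ∑ i, (1 / (Fintype.card ι : ℝ) - if i = a then (g : ℝ) ^ 2 / Fintype.card ι else 0) := by
        simp [Finset.sum_sub_distrib]
    _ ≤ _ := by
        rw [bhattacharyya, Fintype.sum_prod_type]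
        exact Finset.sum_le_sum fun i _ => hpair i

theorem le_sqrt_one_add_sub_sqrt_one_sub (g : unitInterval) : (g : ℝ) ≤ √(1 + g) - √(1 - g) := by
  obtain ⟨hg0, hg1⟩ := g.2
  have hadd := Real.sq_sqrt (show 0 ≤ 1 + (g : ℝ) by linarith)
  have hsub := Real.sq_sqrt (show 0 ≤ 1 - (g : ℝ) by linarith)
  have hmono : √(1 - (g : ℝ)) ≤ √(1 + g) := Real.sqrt_le_sqrt (by linarith)
  have hsum : √(1 + (g : ℝ)) + √(1 - g) ≤ 2 := by
    nlinarith [sq_nonneg (√(1 + (g : ℝ)) - 1), sq_nonneg (√(1 - (g : ℝ)) - 1)]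
  linarith [mul_le_mul_of_nonneg_left hsum (sub_nonneg.2 hmono)]

theorem sq_sub_div_two_le_of_le {a b x y : ℝ} (hba : b ≤ a) (hxy : x ≤ y) :
    (a - b) ^ 2 / 2 ≤ (a - x) ^ 2 + (b - y) ^ 2 := by
  nlinarith [sq_nonneg ((a - x) + (b - y)), mul_nonneg (sub_nonneg.2 hba) (sub_nonneg.2 hxy)]

theorem sq_div_le_sum_bool_sq_sub_sqrt (g : unitInterval) (v : ι → Bool) (a : ι) {w : Bool → ℝ}
    (hw : w (v a) ≤ w (!v a)) :
    (g : ℝ) ^ 2 / (4 * Fintype.card ι) ≤ ∑ b, (√(pairMass g v (a, b)) - w b) ^ 2 := by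
  have hg0 : 0 ≤ (g : ℝ) := g.2.1
  set r : ℝ := √(2 * Fintype.card ι)
  have hr : r ^ 2 = 2 * Fintype.card ι := Real.sq_sqrt (by positivity)
  have hsum : ∑ b, (√(pairMass g v (a, b)) - w b) ^ 2 =
      (√(1 + g) / r - w (v a)) ^ 2 + (√(1 - g) / r - w (!v a)) ^ 2 := by
    cases h : v a <;> simp [pairMass, h, r, Real.sqrt_div', add_comm]
  calc (g : ℝ) ^ 2 / (4 * Fintype.card ι) = (g / r) ^ 2 / 2 := by
        rw [div_pow, hr]
        ring
    _ ≤ (√(1 + g) / r - √(1 - g) / r) ^ 2 / 2 := by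
        rw [← sub_div]
        gcongr
        exact le_sqrt_one_add_sub_sqrt_one_sub g
    _ ≤ _ := by
        rw [hsum]
        refine sq_sub_div_two_le_of_le ?_ hw
        gcongr
        linarith

variable {k : ℕ} (e : ι × Bool ↪ Fin k) (g : unitInterval) (v : ι → Bool)

/-- The distribution with mass function `pairMass g v` on the letters embedded by `e`, the
hypothesis indexed by `v` in Assouad's lemma. -/
noncomputable def pairDistrib : FinDistrib k :=
  ⟨Function.extend e (pairMass g v) 0, by
    refine ⟨fun j => ?_, ?_⟩
    · by_cases h : ∃ x, e x = j
      · obtain ⟨x, rfl⟩ := h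
        rw [e.injective.extend_apply]
        exact pairMass_nonneg g v x
      · rw [Function.extend_apply' _ _ _ h, Pi.zero_apply]
    · rw [← sum_pairMass (g : ℝ) v]
      exact (Fintype.sum_of_injective e e.injective (pairMass g v)
        (Function.extend e (pairMass g v) 0) (fun j hj => Function.extend_apply' _ _ _ hj)
        fun x => (e.injective.extend_apply _ _ x).symm).symm⟩

theorem pairDistrib_apply (x : ι × Bool) : (pairDistrib e g v).1 (e x) = pairMass g v x :=
  e.injective.extend_apply _ _ _

theorem pairDistrib_apply_of_notMem {j : Fin k} (hj : j ∉ Set.range e) :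
    (pairDistrib e g v).1 j = 0 :=
  Function.extend_apply' _ _ _ hj

theorem bhattacharyya_pairDistrib (w : ι → Bool) :
    bhattacharyya (pairDistrib e g v).1 (pairDistrib e g w).1 =
      bhattacharyya (pairMass g v) (pairMass g w) :=
  (Fintype.sum_of_injective e e.injective _ _
    (fun j hj => by simp [pairDistrib_apply_of_notMem e g v hj])
    fun x => by simp [pairDistrib_apply]).symm

theorem hammingDist_decodedBits_mul_sq_le (q : Fin k → ℝ) :
    hammingDist (decodedBits e q) v * (g : ℝ) ^ 2 ≤
      8 * Fintype.card ι * hellinger (pairDistrib e g v).1 q ^ 2 := by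
  set f : Fin k → ℝ := fun j => (√((pairDistrib e g v).1 j) - √(q j)) ^ 2
  have hpair : hammingDist (decodedBits e q) v * ((g : ℝ) ^ 2 / (4 * Fintype.card ι)) ≤
      ∑ x, f (e x) := by
    simp only [f, pairDistrib_apply, Fintype.sum_prod_type]
    rw [hammingDist, ← nsmul_eq_mul]
    refine (Finset.card_nsmul_le_sum _ _ _ fun a ha => ?_).trans
      (Finset.sum_le_sum_of_subset_of_nonneg (Finset.filter_subset _ _) fun _ _ _ => by positivity)
    exact sq_div_le_sum_bool_sq_sub_sqrt g v a (w := fun b => √(q (e (a, b))))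
      (Real.sqrt_le_sqrt (apply_le_of_decodedBits_ne (Finset.mem_filter.1 ha).2))
  have hle : ∑ x, f (e x) ≤ ∑ j, f j := by
    rw [← Finset.sum_map Finset.univ e f]
    exact Finset.sum_le_sum_of_subset_of_nonneg (Finset.subset_univ _) fun _ _ _ => sq_nonneg _
  rw [hellinger_sq]
  calc _ = 4 * Fintype.card ι *
        (hammingDist (decodedBits e q) v * ((g : ℝ) ^ 2 / (4 * Fintype.card ι))) := by field_simp
    _ ≤ 4 * Fintype.card ι * ∑ j, f j := by
      gcongr
      exact hpair.trans hle
    _ = _ := by ring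

end PairedPerturbation

section LowerBound

/-- The learner `κ` outputs a distribution at Hellinger distance greater than `ε` from the unknown
one with probability at most `δ`. -/
def IsHellingerLearner {k n : ℕ} (κ : Kernel (Fin n → Fin k) (FinDistrib k)) (ε δ : ℝ) : Prop :=
  ∀ p : FinDistrib k,
    ((sampleLaw n p).bind κ).real {q : FinDistrib k | ε < hellinger p.1 q.1} ≤ δ

theorem Learnable.exists_isHellingerLearner {k n : ℕ} {ε δ : ℝ}
    (h : Learnable k hellinger ε δ n) :
    ∃ κ : Kernel (Fin n → Fin k) (FinDistrib k), IsMarkovKernel κ ∧ IsHellingerLearner κ ε δ := by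
  obtain ⟨κ, hκ, hlearn⟩ := h
  refine ⟨κ, hκ, fun p => ?_⟩
  have hcompl := probReal_compl_eq_one_sub (μ := (sampleLaw n p).bind κ)
    (measurableSet_le (measurable_hellinger p.1) (measurable_const (a := ε)))
  have hsuccess := (ENNReal.ofReal_le_iff_le_toReal (measure_ne_top _ _)).1 (hlearn p)
  simp only [Set.compl_ofPred, not_le, Measure.real] at hcompl ⊢
  linarith

theorem exists_le_sum_of_le_add_flipBit {ι : Type*} [Fintype ι] [DecidableEq ι]
    (M : (ι → Bool) → ι → ℝ) {c : ℝ} (hM : ∀ v a, c ≤ M v a + M (flipBit a v) a) :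
    ∃ v, Fintype.card ι * (c / 2) ≤ ∑ a, M v a := by
  have hcoord (a : ι) : ∑ _v : ι → Bool, c / 2 ≤ ∑ v, M v a := by
    have hflip : ∑ v, M (flipBit a v) a = ∑ v, M v a :=
      Equiv.sum_comp (flipBit_involutive a).toPerm fun v => M v a
    have hadd := Finset.sum_le_sum fun v (_ : v ∈ Finset.univ) => hM v a
    rw [Finset.sum_add_distrib, hflip] at hadd
    rw [← Finset.sum_div]
    linarith
  have hsum : ∑ _v : ι → Bool, Fintype.card ι * (c / 2) ≤ ∑ v, ∑ a, M v a := by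
    rw [Finset.sum_comm]
    calc _ = ∑ _a : ι, ∑ _v : ι → Bool, c / 2 := by
          simp only [Finset.sum_const, Finset.card_univ, nsmul_eq_mul]
          ring
      _ ≤ _ := Finset.sum_le_sum fun a _ => hcoord a
  obtain ⟨v, -, hv⟩ := Finset.exists_le_of_sum_le Finset.univ_nonempty hsum
  exact ⟨v, hv⟩

theorem integral_hammingDist {Ω ι : Type*} [MeasurableSpace Ω] [Fintype ι] (μ : Measure Ω)
    [IsFiniteMeasure μ] {f : Ω → ι → Bool} (hf : Measurable f) (v : ι → Bool) :
    ∫ ω, (hammingDist (f ω) v : ℝ) ∂μ = ∑ a, μ.real {ω | f ω a ≠ v a} := by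
  have hmeas (a) : MeasurableSet {ω | f ω a ≠ v a} :=
    ((measurable_pi_apply a).comp hf) (MeasurableSet.singleton (v a)).compl
  have hsum (ω) : (hammingDist (f ω) v : ℝ) =
      ∑ a, {ω | f ω a ≠ v a}.indicator (fun _ => (1 : ℝ)) ω := by
    simp [hammingDist, Set.indicator_apply, Finset.natCast_card_filter]
  simp only [hsum]
  rw [integral_finsetSum _ fun a _ => (integrable_const _).indicator (hmeas a)]
  simp [integral_indicator_const, hmeas]

theorem integral_le_add_measureReal_mul_of_le_add_indicator {Ω : Type*} [MeasurableSpace Ω]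
    (μ : Measure Ω) [IsProbabilityMeasure μ] {X : Ω → ℝ} {D : Set Ω} {a b : ℝ} (hX : ∀ ω, 0 ≤ X ω)
    (hD : MeasurableSet D) (h : ∀ ω, X ω ≤ a + D.indicator (fun _ => b) ω) :
    ∫ ω, X ω ∂μ ≤ a + μ.real D * b := by
  have hint : Integrable (D.indicator fun _ => b) μ := (integrable_const b).indicator hD
  calc ∫ ω, X ω ∂μ ≤ ∫ ω, a + D.indicator (fun _ => b) ω ∂μ :=
        integral_mono_of_nonneg (.of_forall hX) ((integrable_const a).add hint) (.of_forall h)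
    _ = a + μ.real D * b := by
        rw [integral_add (integrable_const a) hint, integral_indicator_const b hD]
        simp

variable {ι : Type*} {k n : ℕ} {ε δ : ℝ}

theorem measurable_decodedBits (e : ι × Bool → Fin k) :
    Measurable fun q : FinDistrib k => decodedBits e q.1 :=
  measurable_pi_lambda _ fun a => measurable_to_bool <| by
    simpa [decodedBits, Set.preimage] using
      measurableSet_lt (FinDistrib.measurable_apply _) (FinDistrib.measurable_apply _)

variable [Fintype ι] [Nonempty ι] (e : ι × Bool ↪ Fin k) (g : unitInterval)
  (κ : Kernel (Fin n → Fin k) (FinDistrib k)) [IsMarkovKernel κ]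

/-- The probability that decoding the output of the learner `κ` misses the bit `a` when the samples
come from `pairDistrib e g v`. -/
noncomputable def bitErrorProb (v : ι → Bool) (a : ι) : ℝ :=
  ((sampleLaw n (pairDistrib e g v)).bind κ).real {q : FinDistrib k | decodedBits e q.1 a ≠ v a}

theorem one_sub_pow_sq_le_bitErrorProb_add_flipBit [DecidableEq ι] (v : ι → Bool) (a : ι) :
    ((1 - (g : ℝ) ^ 2 / Fintype.card ι) ^ n) ^ 2 ≤
      2 * (bitErrorProb e g κ v a + bitErrorProb e g κ (flipBit a v) a) := by
  have hmeas : MeasurableSet {q : FinDistrib k | decodedBits e q.1 a ≠ v a} :=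
    ((measurable_pi_apply a).comp (measurable_decodedBits e)) (MeasurableSet.singleton (v a)).compl
  have hcompl : {q : FinDistrib k | decodedBits e q.1 a ≠ v a}ᶜ =
      {q : FinDistrib k | decodedBits e q.1 a ≠ flipBit a v a} := by
    ext q
    simp [flipBit]
  have hbase : 0 ≤ 1 - (g : ℝ) ^ 2 / Fintype.card ι := by
    have hcard : (1 : ℝ) ≤ Fintype.card ι := by exact_mod_cast Fintype.card_pos (α := ι)
    have hg : (g : ℝ) ^ 2 ≤ 1 := pow_le_one₀ g.2.1 g.2.2
    exact sub_nonneg.2 (div_le_one_of_le₀ (hg.trans hcard) (by positivity))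
  have htwoPoint : (1 - (g : ℝ) ^ 2 / Fintype.card ι) ^ n ≤
      √(bitErrorProb e g κ v a) + √(bitErrorProb e g κ (flipBit a v) a) := by
    refine (pow_le_pow_left₀ hbase (bhattacharyya_pairMass_flipBit_ge g v a) n).trans ?_
    rw [← bhattacharyya_pairDistrib e, bitErrorProb, bitErrorProb, ← hcompl]
    exact bhattacharyya_pow_le_sqrt_bind_add_sqrt_bind_compl κ _ _ hmeas
  refine (pow_le_pow_left₀ (pow_nonneg hbase n) htwoPoint 2).trans (add_sq_le.trans_eq ?_)
  rw [bitErrorProb, bitErrorProb, Real.sq_sqrt measureReal_nonneg, Real.sq_sqrt measureReal_nonneg]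

theorem hammingDist_decodedBits_mul_sq_le_add_indicator (v : ι → Bool) (ε : ℝ)
    (q : FinDistrib k) :
    hammingDist (decodedBits e q.1) v * (g : ℝ) ^ 2 ≤ Fintype.card ι * (8 * ε ^ 2) +
      {q : FinDistrib k | ε < hellinger (pairDistrib e g v).1 q.1}.indicator
        (fun _ => Fintype.card ι * (g : ℝ) ^ 2) q := by
  simp only [Set.indicator_apply, Set.mem_ofPred_eq]
  split_ifs with hq
  · have hcard : (hammingDist (decodedBits e q.1) v : ℝ) ≤ Fintype.card ι := by
      exact_mod_cast hammingDist_le_card_fintype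
    exact le_add_of_nonneg_of_le (by positivity) (by gcongr)
  · rw [add_zero]
    calc _ ≤ 8 * Fintype.card ι * hellinger (pairDistrib e g v).1 q.1 ^ 2 :=
          hammingDist_decodedBits_mul_sq_le e g v q.1
      _ ≤ 8 * Fintype.card ι * ε ^ 2 := by
          gcongr
          · exact hellinger_nonneg _ _
          · exact not_lt.1 hq
      _ = _ := by ring

variable {κ}

theorem IsHellingerLearner.sum_bitErrorProb_mul_sq_le (h : IsHellingerLearner κ ε δ)
    (v : ι → Bool) :
    (∑ a, bitErrorProb e g κ v a) * (g : ℝ) ^ 2 ≤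
      Fintype.card ι * (8 * ε ^ 2 + δ * (g : ℝ) ^ 2) := by
  have hfail := h (pairDistrib e g v)
  simp only [bitErrorProb]
  rw [← integral_hammingDist _ (measurable_decodedBits e), ← integral_mul_const]
  calc _ ≤ Fintype.card ι * (8 * ε ^ 2) +
        ((sampleLaw n (pairDistrib e g v)).bind κ).real
          {q : FinDistrib k | ε < hellinger (pairDistrib e g v).1 q.1} *
          (Fintype.card ι * (g : ℝ) ^ 2) :=
        integral_le_add_measureReal_mul_of_le_add_indicator _ (fun q => by positivity)
          (measurableSet_lt measurable_const (measurable_hellinger _))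
          (hammingDist_decodedBits_mul_sq_le_add_indicator e g v ε)
    _ ≤ Fintype.card ι * (8 * ε ^ 2) + δ * (Fintype.card ι * (g : ℝ) ^ 2) := by gcongr
    _ = _ := by ring

theorem IsHellingerLearner.one_sub_pow_sq_mul_sq_le (e : ι × Bool ↪ Fin k) (g : unitInterval)
    (h : IsHellingerLearner κ ε δ) :
    ((1 - (g : ℝ) ^ 2 / Fintype.card ι) ^ n) ^ 2 * (g : ℝ) ^ 2 ≤
      4 * (8 * ε ^ 2 + δ * (g : ℝ) ^ 2) := by
  classical
  set c := ((1 - (g : ℝ) ^ 2 / Fintype.card ι) ^ n) ^ 2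
  obtain ⟨v, hv⟩ := exists_le_sum_of_le_add_flipBit (bitErrorProb e g κ) (c := c / 2) fun v a => by
    linarith [one_sub_pow_sq_le_bitErrorProb_add_flipBit e g κ v a]
  have hcard : (0 : ℝ) < Fintype.card ι := by exact_mod_cast Fintype.card_pos
  refine le_of_mul_le_mul_left ?_ hcard
  calc _ = 4 * (Fintype.card ι * (c / 2 / 2) * (g : ℝ) ^ 2) := by ring
    _ ≤ 4 * ((∑ a, bitErrorProb e g κ v a) * (g : ℝ) ^ 2) := by gcongr
    _ ≤ 4 * (Fintype.card ι * (8 * ε ^ 2 + δ * (g : ℝ) ^ 2)) :=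
        mul_le_mul_of_nonneg_left (h.sum_bitErrorProb_mul_sq_le e g v) (by norm_num)
    _ = _ := by ring

theorem IsHellingerLearner.bitErrorProb_le (h : IsHellingerLearner κ ε δ)
    (hε : 8 * Fintype.card ι * ε ^ 2 < (g : ℝ) ^ 2) (v : ι → Bool) (a : ι) :
    bitErrorProb e g κ v a ≤ δ := by
  refine (measureReal_mono fun q hq => Set.mem_ofPred.2 ?_).trans (h (pairDistrib e g v))
  have hone : (1 : ℝ) ≤ hammingDist (decodedBits e q.1) v := by
    exact_mod_cast hammingDist_pos.2 (Function.ne_iff.2 ⟨a, hq⟩)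
  have hsep := hammingDist_decodedBits_mul_sq_le e g v q.1
  refine lt_of_pow_lt_pow_left₀ 2 (hellinger_nonneg _ _) (lt_of_mul_lt_mul_left (hε.trans_le ?_)
    (by positivity : (0 : ℝ) ≤ 8 * Fintype.card ι))
  exact (le_mul_of_one_le_left (sq_nonneg _) hone).trans hsep

theorem IsHellingerLearner.card_le (e : ι × Bool ↪ Fin k) (h : IsHellingerLearner κ ε δ)
    (hε : 0 < ε) (hε' : 12 * ε ≤ 1) (hδ : δ ≤ 1 / 18) :
    (Fintype.card ι : ℝ) ≤ 432 * (n * ε ^ 2) := by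
  -- The tilt `12 * ε` turns `8 * ε ^ 2` into `1 / 18` of its square.
  have hassouad := h.one_sub_pow_sq_mul_sq_le e ⟨12 * ε, by positivity, hε'⟩
  simp only at hassouad
  have hcard : (1 : ℝ) ≤ Fintype.card ι := by exact_mod_cast Fintype.card_pos (α := ι)
  set t : ℝ := (12 * ε) ^ 2 / Fintype.card ι with ht
  have ht1 : t ≤ 1 :=
    div_le_one_of_le₀ ((pow_le_one₀ (by positivity) hε').trans hcard) (by positivity)
  have hbernoulli : 1 - n * t ≤ (1 - t) ^ n := by
    have := one_add_mul_le_pow (show (-2 : ℝ) ≤ -t by linarith) n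
    rwa [mul_neg, ← sub_eq_add_neg, ← sub_eq_add_neg] at this
  have hpow : (1 - t) ^ n ≤ 2 / 3 := by
    have hδε : δ * (12 * ε) ^ 2 ≤ 1 / 18 * (12 * ε) ^ 2 := by gcongr
    refine (abs_le_of_sq_le_sq' ?_ (by norm_num)).2
    refine le_of_mul_le_mul_right ?_ (by positivity : 0 < (12 * ε) ^ 2)
    linarith
  have hnt : 1 / 3 ≤ n * t := by linarith
  rw [ht, ← mul_div_assoc, le_div_iff₀ (by positivity)] at hnt
  linarith

theorem log_one_div_le_of_one_sub_pow_sq_le {t : ℝ} (ht0 : 0 ≤ t) (ht : t ≤ 1 / 2) (hδ0 : 0 < δ)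
    (hδ : δ ≤ 1 / 16) (h : ((1 - t) ^ n) ^ 2 ≤ 4 * δ) : Real.log (1 / δ) ≤ 8 * (n * t) := by
  have hlog : -(2 * t) ≤ Real.log (1 - t) := by
    refine le_trans ?_ (Real.one_sub_inv_le_log_of_pos (by linarith))
    rw [neg_le_sub_iff_le_add, inv_le_iff_one_le_mul₀ (by linarith)]
    nlinarith
  have hupper : 2 * (n * Real.log (1 - t)) ≤ Real.log 4 + Real.log δ := by
    have hpos : 0 < 1 - t := by linarith
    have := Real.log_le_log (by positivity) h
    rwa [Real.log_pow, Real.log_pow, Real.log_mul (by norm_num) hδ0.ne', Nat.cast_ofNat] at this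
  have hsmall : 2 * Real.log 4 ≤ -Real.log δ := by
    have := Real.log_le_log hδ0 hδ
    rw [show (1 / 16 : ℝ) = (4 ^ 2)⁻¹ by norm_num, Real.log_inv, Real.log_pow] at this
    push_cast at this
    linarith
  have hmul := mul_le_mul_of_nonneg_left hlog (Nat.cast_nonneg (α := ℝ) n)
  rw [one_div, Real.log_inv]
  linarith

theorem IsHellingerLearner.log_one_div_le (e : Unit × Bool ↪ Fin k) (h : IsHellingerLearner κ ε δ)
    (hε : 0 < ε) (hε' : ε ≤ 1 / 20) (hδ0 : 0 < δ) (hδ : δ ≤ 1 / 16) :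
    Real.log (1 / δ) ≤ 1152 * (n * ε ^ 2) := by
  let g : unitInterval := ⟨12 * ε, by positivity, by linarith⟩
  have hbit := h.bitErrorProb_le e g (by simp only [g, Fintype.card_unit]; push_cast; nlinarith)
  have htwoPoint := one_sub_pow_sq_le_bitErrorProb_add_flipBit e g κ (fun _ => true) ()
  have hle : ((1 - (12 * ε) ^ 2) ^ n) ^ 2 ≤ 4 * δ := by
    have htrue := hbit (fun _ => true) ()
    have hfalse := hbit (flipBit () fun _ => true) ()
    simp only [g, Fintype.card_unit, Nat.cast_one, div_one] at htwoPoint htrue hfalse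
    linarith
  have hlog := log_one_div_le_of_one_sub_pow_sq_le (by positivity) (by nlinarith) hδ0 hδ hle
  linarith

theorem Learnable.mul_add_log_div_sq_le (hk : 2 ≤ k) (hε : 0 < ε) (hε' : ε ≤ 1 / 20) (hδ0 : 0 < δ)
    (hδ : δ ≤ 1 / 18) (h : Learnable k hellinger ε δ n) :
    1 / 2592 * ((k + Real.log (1 / δ)) / ε ^ 2) ≤ n := by
  obtain ⟨κ, _, hκ⟩ := h.exists_isHellingerLearner
  have : NeZero (k / 2) := ⟨by omega⟩
  obtain ⟨pairs⟩ : Nonempty (Fin (k / 2) × Bool ↪ Fin k) :=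
    Function.Embedding.nonempty_of_card_le (by simp; omega)
  obtain ⟨pair⟩ : Nonempty (Unit × Bool ↪ Fin k) :=
    Function.Embedding.nonempty_of_card_le (by simpa using hk)
  have hcard := hκ.card_le pairs hε (by linarith) hδ
  have hlog := hκ.log_one_div_le pair hε hε' hδ0 (by linarith)
  have hhalf : (k : ℝ) ≤ 3 * (k / 2 : ℕ) := by exact_mod_cast (by omega : k ≤ 3 * (k / 2))
  have hnonneg : 0 ≤ n * ε ^ 2 := by positivity
  rw [Fintype.card_fin] at hcard
  rw [← mul_div_assoc, div_le_iff₀ (by positivity)]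
  linarith

end LowerBound

section SampleComplexity

variable {k n : ℕ} {d : (Fin k → ℝ) → (Fin k → ℝ) → ℝ} {ε δ : ℝ}

theorem sampleComplexity_le (h : Learnable k d ε δ n) :
    (sampleComplexity k d ε δ : ENNReal) ≤ n := by
  have : sampleComplexity k d ε δ ≤ n := iInf₂_le n h
  exact_mod_cast ENat.toENNReal_le.2 this

theorem ofReal_le_sampleComplexity {x : ℝ} (h : ∀ n, Learnable k d ε δ n → x ≤ n) :
    ENNReal.ofReal x ≤ (sampleComplexity k d ε δ : ENNReal) := by
  have hceil : (⌈x⌉₊ : ℕ∞) ≤ sampleComplexity k d ε δ :=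
    le_iInf₂ fun n hn => by exact_mod_cast Nat.ceil_le.2 (h n hn)
  calc ENNReal.ofReal x ≤ ENNReal.ofReal ⌈x⌉₊ := ENNReal.ofReal_le_ofReal (Nat.le_ceil x)
    _ = ((⌈x⌉₊ : ℕ∞) : ENNReal) := by rw [ENat.toENNReal_coe, ENNReal.ofReal_natCast]
    _ ≤ _ := ENat.toENNReal_le.2 hceil

theorem learnable_of_empirical (hn : n ≠ 0)
    (h : ∀ p : FinDistrib k,
      ENNReal.ofReal (1 - δ) ≤ sampleLaw n p {s | hellinger p.1 (empirical s) ≤ ε}) :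
    Learnable k hellinger ε δ n := by
  let f (s : Fin n → Fin k) : FinDistrib k := ⟨empirical s, empirical_mem_stdSimplex hn s⟩
  have hf : Measurable f := measurable_of_countable f
  refine ⟨Kernel.deterministic f hf, inferInstance, fun p => ?_⟩
  rw [Measure.deterministic_comp_eq_map, Measure.map_apply hf
    (measurableSet_le (measurable_hellinger p.1) measurable_const)]
  exact h p

theorem learnable_zero (hk : 1 ≤ k) (hε : 1 ≤ ε) (hδ : 0 ≤ δ) : Learnable k hellinger ε δ 0 := by
  have : NeZero k := ⟨by omega⟩
  refine ⟨Kernel.const _ (Measure.dirac ⟨Pi.single 0 1, single_mem_stdSimplex ℝ 0⟩),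
    inferInstance, fun p => ?_⟩
  have huniv : {q : FinDistrib k | hellinger p.1 q.1 ≤ ε} = Set.univ :=
    Set.eq_univ_of_forall fun q => (hellinger_le_one p q).trans hε
  rw [huniv, measure_univ]
  exact ENNReal.ofReal_le_one.2 (by linarith)

theorem one_le_add_log_one_div (hk : 1 ≤ k) (hδ0 : 0 < δ) (hδ : δ ≤ 1) :
    1 ≤ (k : ℝ) + Real.log (1 / δ) :=
  le_add_of_le_of_nonneg (by exact_mod_cast hk) (Real.log_nonneg (one_le_one_div hδ0 hδ))

theorem ofReal_one_sub_le_sampleLaw_of_mul_div_le (hε : 0 < ε) (hδ0 : 0 < δ) (hδ : δ ≤ 1)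
    (hn : 2 * ((k + Real.log (1 / δ)) / ε ^ 2) ≤ n) (p : FinDistrib k) :
    ENNReal.ofReal (1 - δ) ≤ sampleLaw n p {s | hellinger p.1 (empirical s) ≤ ε} := by
  have hlog : 0 ≤ Real.log (1 / δ) := Real.log_nonneg (one_le_one_div hδ0 hδ)
  rw [← mul_div_assoc, div_le_iff₀ (by positivity)] at hn
  exact ofReal_one_sub_le_sampleLaw_hellinger_empirical_le hε.le hδ0 (by linarith) p

theorem sampleComplexity_hellinger_le (hk : 1 ≤ k) (hε : 0 < ε) (hδ0 : 0 < δ) (hδ : δ ≤ 1) :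
    (sampleComplexity k hellinger ε δ : ENNReal) ≤
      ENNReal.ofReal (4 * ((k + Real.log (1 / δ)) / ε ^ 2)) := by
  have hnum := one_le_add_log_one_div hk hδ0 hδ
  set x := (k + Real.log (1 / δ)) / ε ^ 2
  rcases le_or_gt 1 ε with hε1 | hε1
  · exact (sampleComplexity_le (learnable_zero hk hε1 hδ0.le)).trans (by simp)
  have hx : 1 ≤ x := (one_le_div (by positivity)).2 ((pow_le_one₀ hε.le hε1.le).trans hnum)
  have hlearn : Learnable k hellinger ε δ ⌈2 * x⌉₊ :=
    learnable_of_empirical (Nat.ceil_pos.2 (by linarith)).ne'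
      (ofReal_one_sub_le_sampleLaw_of_mul_div_le hε hδ0 hδ (Nat.le_ceil _))
  refine (sampleComplexity_le hlearn).trans ?_
  rw [← ENNReal.ofReal_natCast]
  exact ENNReal.ofReal_le_ofReal (by linarith [Nat.ceil_lt_add_one (by linarith : 0 ≤ 2 * x)])

end SampleComplexity

theorem mainTheorem2 :
    ∃ c C ε₀ δ₀ : ℝ, 0 < c ∧ 0 < C ∧ 0 < ε₀ ∧ 0 < δ₀ ∧
      -- lower bound, against every (possibly randomized) learner
      (∀ (k : ℕ) (ε δ : ℝ), 2 ≤ k → 0 < ε → ε ≤ ε₀ → 0 < δ → δ ≤ δ₀ →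
        ENNReal.ofReal (c * (((k : ℝ) + Real.log (1 / δ)) / ε ^ 2)) ≤
          (sampleComplexity k hellinger ε δ : ENNReal)) ∧
      -- upper bound
      (∀ (k : ℕ) (ε δ : ℝ), 1 ≤ k → 0 < ε → 0 < δ → δ ≤ 1 →
        (sampleComplexity k hellinger ε δ : ENNReal) ≤
          ENNReal.ofReal (C * (((k : ℝ) + Real.log (1 / δ)) / ε ^ 2))) ∧
      -- the empirical distribution attains the upper bound
      (∀ (k : ℕ) (ε δ : ℝ), 1 ≤ k → 0 < ε → 0 < δ → δ ≤ 1 →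
        ∀ n : ℕ, C * (((k : ℝ) + Real.log (1 / δ)) / ε ^ 2) ≤ (n : ℝ) →
          ∀ p : FinDistrib k,
            ENNReal.ofReal (1 - δ) ≤
              sampleLaw n p {s | hellinger p.1 (empirical s) ≤ ε}) := by
  refine ⟨1 / 2592, 4, 1 / 20, 1 / 18, by norm_num, by norm_num, by norm_num, by norm_num,
    fun k ε δ hk hε hε₀ hδ hδ₀ => ?_, fun k ε δ hk hε hδ hδ₁ => ?_,
    fun k ε δ hk hε hδ hδ₁ n hn p => ?_⟩
  · exact ofReal_le_sampleComplexity fun n hn => hn.mul_add_log_div_sq_le hk hε hε₀ hδ hδ₀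
  · exact sampleComplexity_hellinger_le hk hε hδ hδ₁
  · have hnum := one_le_add_log_one_div hk hδ hδ₁
    refine ofReal_one_sub_le_sampleLaw_of_mul_div_le hε hδ hδ₁ (le_trans ?_ hn) p
    gcongr
    norm_num
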